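/- Setting. A (finite, turn-based) game $G$ consists of a finite directed graph with state set $S$ in which every state has a successor, with strictly positive integer weights on the edges, and a partition $S = S_1 \uplus S_2$ of the states between players $\mathcal P_1$ and $\mathcal P_2$. A strategy of $\mathcal P_i$ maps each prefix ending in $S_i$ to a rational probability distribution on the successors of its last state; it has memory $\mathsf{Mem}$ (a finite set) if it is encoded by a stochastic Moore machine with memory set $\mathsf{Mem}$, deterministic update $\mathsf{Mem}\times S\to\mathsf{Mem}$ (performed when leaving a state) and randomized next-action function $\mathsf{Mem}\times S_i\to\mathcal D(S)$. For $T\subseteq S$ the truncated sum $\mathsf{TS}^T(\pi)$ of a play $\pi$ is the sum of its weights up to the first visit of $T$, and $\infty$ if $T$ is never visited. Given an initial state $s_{\rm init}$, a target $T$, a stochastic model of $\mathcal P_2$ given by a Moore machine $M_2$ with memory $\mathsf{Mem}_2$, and thresholds $\mu\in\mathbb N$, $\nu\in\mathbb Q$, a finite-memory strategy $\lambda_1$ of $\mathcal P_1$ satisfies the beyond worst-case (BWC) problem if $\mathsf{TS}^T(\pi)<\mu$ for every play $\pi$ from $s_{\rm init}$ consistent with $\lambda_1$ and some strategy of $\mathcal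 P_2$, and the expectation of $\mathsf{TS}^T$ from $s_{\rm init}$ in the Markov chain $G[\lambda_1,M_2]$ is $<\nu$. The unfolded product $G_\mu\otimes M_2$ has states $(s,u,m)\in S\times(\{0,\dots,\mu-1\}\cup\{\top\})\times\mathsf{Mem}_2$, where $u$ is the running sum of weights ($\top$ if it is at least $\mu$) and $m$ is the memory of $M_2$; an edge leads from $(s,u,m)$ to $(s',u+w(s,s'),m')$ for each edge $(s,s')$ of $G$, where $m'$ is the update of $m$ at $s$. Its target consists of the states with $s\in T$ and $u\neq\top$, and its winning region is the set of states from which $\mathcal P_1$ can force reaching this target. Theorem. (1) (Pseudo-polynomial memory always suffices.) For all $G$, $s_{\rm init}$, $T$, $M_2$, $\mu$, $\nu$: if some finite-memory strategy satisfies the BWC problem, then there is a memoryless strategy $\sigma$ of $\mathcal P_1$ on the unfolded product which, before the target, never leaves the winning region from inside it, and such that the strategy of $G$ that plays like $\sigma$ in $(s,u,m)$ after every prefix ending in $s$ with running sum $u$ and current memory $m$ of $M_2$ satisfies the BWC problem. This strategy is encoded by a Moore machine with memory $(S\cup\{\bot\})\times(\{0,\dots,\mu-1\}\cup\{\top\})\times\mathsf{Mem}_2$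 (state left last, running sum, memory of $M_2$), hence with at most $(|S|+1)(\mu+1)|\mathsf{Mem}_2|$ memory elements, which is polynomial in the size of the game, the size of the stochastic model, and $\mu$. (2) (Memory linear in $\mu$ may be necessary.) For $\mu\in\{13+4k\mid k\in\mathbb N\}$ let $G(\mu)$ be the game with states $s_1,s_3$ of $\mathcal P_1$ and $s_2$ of $\mathcal P_2$, and edges $s_1\to s_2$, $s_1\to s_3$, $s_2\to s_1$, $s_2\to s_3$, $s_3\to s_3$, all of weight $1$ except $s_1\to s_3$, which has weight $\lfloor\mu/2\rfloor$. Take $s_{\rm init}=s_1$, $T=\{s_3\}$, and the memoryless stochastic model that chooses uniformly between $s_1$ and $s_3$ in $s_2$. For each such $\mu$ there is $\nu\in\mathbb Q$ with $\nu<\mu$ such that some finite-memory strategy satisfies the BWC problem with thresholds $(\mu,\nu)$, and every Moore machine of $\mathcal P_1$ whose strategy satisfies it has more than $\mu/4$ memory elements. -/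

import Mathlib

namespace BWC

open scoped ENNReal

/-- A rational probability distribution on a finite set `A`. -/
structure RatDist (A : Type*) [Fintype A] where
  prob : A → ℚ
  nonneg : ∀ a, 0 ≤ prob a
  sum_one : ∑ a, prob a = 1

namespace RatDist

variable {A B : Type*} [Fintype A] [Fintype B]

/-- `a` lies in the support of the distribution. -/
def InSupp (p : RatDist A) (a : A) : Prop := 0 < p.prob a

open Classical in
/-- The image distribution under `f`. -/
noncomputable def map (f : A → B) (p : RatDist A) : RatDist B where
  prob b := ∑ a with f a = b, p.prob a
  nonneg _ := Finset.sum_nonneg fun a _ => p.nonneg a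
  sum_one := (Finset.sum_fiberwise Finset.univ f p.prob).trans p.sum_one

/-- The distribution as a probability mass function. -/
noncomputable def toPMF (p : RatDist A) : PMF A :=
  PMF.ofFintype (fun a => ENNReal.ofReal (p.prob a : ℝ)) <| by
    rw [← ENNReal.ofReal_sum_of_nonneg (fun a _ => by exact_mod_cast p.nonneg a),
      ← Rat.cast_sum, p.sum_one]
    simp

theorem exists_of_map_inSupp {f : A → B} {p : RatDist A} {b : B} (h : (p.map f).InSupp b) :
    ∃ a, f a = b ∧ p.InSupp a := by
  classical
  obtain ⟨a, ha, hp⟩ := Finset.exists_lt_of_sum_lt (s := Finset.univ.filter (fun a => f a = b))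
    (f := fun _ => (0 : ℚ)) (g := p.prob) (by
      have h' := h
      simp only [InSupp, map] at h'
      simpa using h')
  exact ⟨a, by simpa using ha, hp⟩

end RatDist

/-! ### Markov chains -/

/-- The law on infinite sequences of states of the Markov chain with finite state space `X`,
transition function `δ` and initial state `x`. Sequences carry the product of the discrete
σ-algebras, that is, the σ-algebra generated by the cylinder sets. -/
noncomputable def chainLaw {X : Type*} [Fintype X] (δ : X → RatDist X) (x : X) :
    @MeasureTheory.Measure (ℕ → X) (@MeasurableSpace.pi ℕ (fun _ => X) (fun _ => ⊤)) :=
  letI : MeasurableSpace X := ⊤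
  let step : ProbabilityTheory.Kernel X X :=
    ProbabilityTheory.Kernel.ofFunOfCountable fun y => (δ y).toPMF.toMeasure
  haveI : ProbabilityTheory.IsMarkovKernel step :=
    ⟨fun y => inferInstanceAs (MeasureTheory.IsProbabilityMeasure (δ y).toPMF.toMeasure)⟩
  ProbabilityTheory.Kernel.traj (X := fun _ => X)
    (fun n => step.comap (fun h : (i : Finset.Iic n) → X => h ⟨n, Finset.mem_Iic.2 le_rfl⟩)
      (measurable_pi_apply _)) 0 (fun _ => x)

/-! ### Games, strategies, Moore machines -/

/-- The two players. -/
inductive Player where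
  | one
  | two

/-- A two-player turn-based game on a non-blocking directed graph with state set `S` whose edges
carry strictly positive integer weights; `owner` is the partition of the states between the
players. Values of `weight` off the edges are irrelevant. -/
structure Game (S : Type*) where
  edge : S → S → Prop
  weight : S → S → ℕ
  owner : S → Player
  nonblocking : ∀ s, ∃ t, edge s t
  weight_pos : ∀ s t, edge s t → 0 < weight s t

/-- A (possibly randomized, infinite-memory) strategy of player `i`: `act h s` is the distribution
chosen after the prefix `h · s`. Only its values on prefixes in the graph that end in a
state of player `i` matter. -/
structure Strategy {S : Type*} [Fintype S] (G : Game S) (i : Player) where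
  act : List S → S → RatDist S
  supp : ∀ h s, List.IsChain G.edge (h ++ [s]) → G.owner s = i →
    ∀ t, (act h s).InSupp t → G.edge s t

/-- A stochastic Moore machine for player `i` with memory set `Mem`: deterministic update,
randomized next-action function. Only the values of `next` on states of player `i` matter. -/
structure MooreMachine {S : Type*} [Fintype S] (G : Game S) (i : Player) (Mem : Type*) where
  init : Mem
  update : Mem → S → Mem
  next : Mem → S → RatDist S
  supp : ∀ m s, G.owner s = i → ∀ t, (next m s).InSupp t → G.edge s t

variable {S : Type*} [Fintype S]

/-- The finite-memory strategy encoded by a Moore machine. -/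
def MooreMachine.toStrategy {G : Game S} {i : Player} {Mem : Type*}
    (M : MooreMachine G i Mem) : Strategy G i where
  act h s := M.next (h.foldl M.update M.init) s
  supp _ s _ hs := M.supp _ s hs

/-- The play `π` is consistent with the strategy `σ` of player `i`. -/
def Strategy.Consistent {G : Game S} {i : Player} (σ : Strategy G i) (π : ℕ → S) : Prop :=
  ∀ n, G.owner (π n) = i → (σ.act ((List.range n).map π) (π n)).InSupp (π (n + 1))

/-- The outcomes from `s₀`: the plays from `s₀` consistent with both strategies. -/
def Game.outcomes (G : Game S) (s₀ : S) (σ₁ : Strategy G .one) (σ₂ : Strategy G .two) :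
    Set (ℕ → S) :=
  {π | π 0 = s₀ ∧ (∀ n, G.edge (π n) (π (n + 1))) ∧ σ₁.Consistent π ∧ σ₂.Consistent π}

open Classical in
/-- The truncated sum up to `T`: the sum of the weights before the first visit of `T`, and `∞`
if `T` is never visited. -/
noncomputable def Game.truncatedSum (G : Game S) (T : Set S) (π : ℕ → S) : ℕ∞ :=
  if h : ∃ n, π n ∈ T then
    ((∑ i ∈ Finset.range (Nat.find h), G.weight (π i) (π (i + 1)) : ℕ) : ℕ∞)
  else ⊤

/-- The transition function of the Markov chain obtained from `G` by fixing a Moore machine for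
each player; its states are triples (state, memory of player one, memory of player two). -/
noncomputable def productStep {G : Game S} {Mem₁ Mem₂ : Type*} [Fintype Mem₁] [Fintype Mem₂]
    (M₁ : MooreMachine G .one Mem₁) (M₂ : MooreMachine G .two Mem₂) :
    S × Mem₁ × Mem₂ → RatDist (S × Mem₁ × Mem₂)
  | (s, m₁, m₂) =>
    (match G.owner s with
      | .one => M₁.next m₁ s
      | .two => M₂.next m₂ s).map fun t => (t, M₁.update m₁ s, M₂.update m₂ s)

/-- The expectation of the truncated sum from `s₀` in the Markov chain `G[M₁, M₂]`, evaluated on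
the projection of its outcomes to the states of `G`. -/
noncomputable def expectedCost {G : Game S} {Mem₁ Mem₂ : Type*} [Fintype Mem₁] [Fintype Mem₂]
    (T : Set S) (s₀ : S) (M₁ : MooreMachine G .one Mem₁) (M₂ : MooreMachine G .two Mem₂) : ℝ≥0∞ :=
  ∫⁻ x, (G.truncatedSum T (fun n => (x n).1) : ℝ≥0∞)
    ∂(chainLaw (productStep M₁ M₂) (s₀, M₁.init, M₂.init))

/-- The finite-memory strategy `M₁` satisfies the beyond worst-case problem for the shortest path:
every outcome against every strategy of player two costs strictly less than `μ`, and the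
expected cost against the stochastic model `M₂` is strictly less than `ν`. (As costs are
nonnegative, comparing with `ENNReal.ofReal ν` is the same as comparing with `ν`.) -/
def Satisfies {G : Game S} {Mem₁ Mem₂ : Type*} [Fintype Mem₁] [Fintype Mem₂]
    (s₀ : S) (T : Set S) (M₂ : MooreMachine G .two Mem₂) (μ : ℕ) (ν : ℚ)
    (M₁ : MooreMachine G .one Mem₁) : Prop :=
  (∀ σ₂ : Strategy G .two, ∀ π ∈ G.outcomes s₀ M₁.toStrategy σ₂,
    G.truncatedSum T π < (μ : ℕ∞)) ∧
  expectedCost T s₀ M₁ M₂ < ENNReal.ofReal (ν : ℝ)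

/-- The set of states from which player one can force a visit of `A`, as a least fixed point. -/
inductive Game.Attr (G : Game S) (A : Set S) : S → Prop
  | base (s : S) : s ∈ A → Game.Attr G A s
  | one (s t : S) : G.owner s = .one → G.edge s t → Game.Attr G A t → Game.Attr G A s
  | two (s : S) : G.owner s = .two → (∀ t, G.edge s t → Game.Attr G A t) → Game.Attr G A s

/-! ### The unfolded product -/

/-- Running sums below `μ`, together with `none` for all sums that are at least `μ`. -/
abbrev Counter (μ : ℕ) : Type := Option (Fin μ)

/-- The counter value of the sum `k`. -/
def Counter.ofNat (μ k : ℕ) : Counter μ := if h : k < μ then some ⟨k, h⟩ else none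

/-- Adding a weight to a counter value. -/
def Counter.add {μ : ℕ} (u : Counter μ) (c : ℕ) : Counter μ :=
  u.bind fun v => Counter.ofNat μ (v + c)

/-- The product of the unfolding of `G` (which tracks the running sum of the weights up to `μ`)
with the Moore machine `M₂`. -/
def unfoldedProduct {G : Game S} {Mem₂ : Type*} (M₂ : MooreMachine G .two Mem₂) (μ : ℕ) :
    Game (S × Counter μ × Mem₂) where
  edge x y := G.edge x.1 y.1 ∧ y.2.1 = x.2.1.add (G.weight x.1 y.1) ∧
    y.2.2 = M₂.update x.2.2 x.1
  weight x y := G.weight x.1 y.1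
  owner x := G.owner x.1
  nonblocking x := by
    obtain ⟨t, ht⟩ := G.nonblocking x.1
    exact ⟨(t, x.2.1.add (G.weight x.1 t), M₂.update x.2.2 x.1), ht, rfl, rfl⟩
  weight_pos x y h := G.weight_pos _ _ h.1

/-- The target of the unfolded product: copies of states of `T` reached with a sum below `μ`. -/
def unfoldedTarget (T : Set S) (μ : ℕ) (Mem₂ : Type*) : Set (S × Counter μ × Mem₂) :=
  {x | x.1 ∈ T ∧ x.2.1 ≠ none}

/-- The winning region of player one in the unfolded product. -/
def winningRegion {G : Game S} {Mem₂ : Type*} [Fintype Mem₂] (T : Set S)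
    (M₂ : MooreMachine G .two Mem₂) (μ : ℕ) : Set (S × Counter μ × Mem₂) :=
  {x | (unfoldedProduct M₂ μ).Attr (unfoldedTarget T μ Mem₂) x}

/-- A memoryless strategy `σ` of the unfolded product never leaves the winning region before the
target is reached, so that it is a strategy of the restriction to the winning region. -/
def StaysInWinningRegion {G : Game S} {Mem₂ : Type*} [Fintype Mem₂] (T : Set S)
    (M₂ : MooreMachine G .two Mem₂) (μ : ℕ)
    (σ : MooreMachine (unfoldedProduct M₂ μ) .one Unit) : Prop :=
  ∀ x ∈ winningRegion T M₂ μ, x ∉ unfoldedTarget T μ Mem₂ → (unfoldedProduct M₂ μ).owner x = .one →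
    ∀ y, (σ.next () x).InSupp y → y ∈ winningRegion T M₂ μ

/-- Memory for playing a memoryless strategy of the unfolded product in the original game:
the state left last (if any), the running sum on entering it, and the memory of the
stochastic model. The state left last is needed because the update function of a Moore machine
reads a single state, while weights belong to edges. -/
abbrev UnfoldedMemory (S : Type*) (μ : ℕ) (Mem₂ : Type*) := Option S × Counter μ × Mem₂

/-- The running sum on entering the current state `s`. -/
def currentSum (G : Game S) {μ : ℕ} : Option S → Counter μ → S → Counter μ
  | none, u, _ => u
  | some r, u, s => u.add (G.weight r s)

/-- The strategy of `G` that plays the memoryless strategy `σ` of the unfolded product: after a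
prefix ending in `s` with running sum `u`, and with `m` the current memory of `M₂`, it plays
like `σ` in `(s, u, m)`. -/
noncomputable def translateBack {G : Game S} {Mem₂ : Type*} [Fintype Mem₂]
    (M₂ : MooreMachine G .two Mem₂) (μ : ℕ)
    (σ : MooreMachine (unfoldedProduct M₂ μ) .one Unit) :
    MooreMachine G .one (UnfoldedMemory S μ Mem₂) where
  init := (none, Counter.ofNat μ 0, M₂.init)
  update m s := (some s, currentSum G m.1 m.2.1 s, M₂.update m.2.2 s)
  next m s := (σ.next () (s, currentSum G m.1 m.2.1 s, m.2.2)).map Prod.fst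
  supp m s hs t ht := by
    obtain ⟨y, rfl, hy⟩ := RatDist.exists_of_map_inSupp ht
    exact (σ.supp () (s, currentSum G m.1 m.2.1 s, m.2.2) hs y hy).1

/-! ### The three-state family -/

/-- The three states of the family. -/
inductive Three where
  | s₁
  | s₂
  | s₃
  deriving DecidableEq

instance : Fintype Three := ⟨{.s₁, .s₂, .s₃}, by intro x; cases x <;> decide⟩

/-- The game `G(μ)`: edges `s₁ → s₂`, `s₁ → s₃`, `s₂ → s₁`, `s₂ → s₃`, `s₃ → s₃`, all of
weight `1` except `s₁ → s₃`, which has weight `⌊μ/2⌋`; player two owns `s₂`. -/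
def familyGame (μ : ℕ) (hμ : 2 ≤ μ) : Game Three where
  edge
    | .s₁, t => t = .s₂ ∨ t = .s₃
    | .s₂, t => t = .s₁ ∨ t = .s₃
    | .s₃, t => t = .s₃
  weight
    | .s₁, .s₃ => μ / 2
    | _, _ => 1
  owner
    | .s₂ => .two
    | _ => .one
  nonblocking
    | .s₁ => ⟨.s₂, Or.inl rfl⟩
    | .s₂ => ⟨.s₁, Or.inl rfl⟩
    | .s₃ => ⟨.s₃, rfl⟩
  weight_pos s t _ := by cases s <;> cases t <;> (simp; try omega)

/-- The uniform distribution on `{s₁, s₃}`. -/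
def uniformS₁S₃ : RatDist Three where
  prob
    | .s₂ => 0
    | _ => 1 / 2
  nonneg a := by cases a <;> norm_num
  sum_one := by
    have : (Finset.univ : Finset Three) = {.s₁, .s₂, .s₃} := rfl
    rw [this, Finset.sum_insert (by decide), Finset.sum_insert (by decide), Finset.sum_singleton]
    norm_num

/-- The memoryless stochastic model of player two in `G(μ)`: uniform in `s₂`. -/
def familyModel (μ : ℕ) (hμ : 2 ≤ μ) : MooreMachine (familyGame μ hμ) .two Unit where
  init := ()
  update _ _ := ()
  next _ _ := uniformS₁S₃
  supp _ s hs t ht := by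
    cases s <;> cases t <;> simp_all [familyGame, uniformS₁S₃, RatDist.InSupp]

end BWC

/-!
In the unfolded product the running sum grows along every edge until the counter overflows, so that
before the target only finitely many steps are possible. Both parts rest on this and on first-step
analysis: `lintegral_chainLaw` is the Markov property of `chainLaw` at time one, from which
`costFrom_of_notMem` expresses the expected cost from a state through the expected costs from its
successors. On the side of the worst case, `SafeFrom` says that all continuations stay below `μ`. By
`forall_outcomes_iff_safeFrom` it is the worst-case requirement (every play is consistent with the
strategy of player two that picks uniformly among all successors), and it is inherited along the
moves a machine allows.

*Memory that suffices.* Let `optimalValue` be the least solution of the Bellman equation on the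
winning region of the unfolded product. Before the target, a safe machine never leaves this region
(`SafeFrom.mem_winningRegion`), hence by induction on the distance of the running sum to `μ` its
expected cost is at least the optimal value (`SafeFrom.optimalValue_le_costFrom`). The memoryless
strategy that moves to a minimizing successor attains this value
(`costFrom_translateBack_le`), and it is safe because it stays in the winning region
(`safeFrom_translateBack`). So it satisfies the problem as soon as any machine does.

*Memory that is necessary.* For `μ = 13 + 4 * k`, moving `i` times from `s₁` to `s₂` before moving
to `s₃` has expected cost `4 + (2 * k + 2) / 2 ^ i`, which decreases in `i`, while the worst case
permits `k + 3` loops and no more. With the cost of `k + 2` loops as threshold, a machine has to be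
able to loop `k + 3` times (`loopValue_le_costFrom`) and must not loop once more
(`SafeFrom.add_half_lt`). Its memory in `s₁` evolves deterministically along the loops, so
the `k + 4` memory elements met there are distinct (`Satisfies.le_card`).
-/

namespace BWC

open scoped ENNReal
open MeasureTheory ProbabilityTheory

/-! ### First-step analysis of Markov chains -/

section Chain

variable {X : Type*} [Fintype X]

theorem measure_ext_of_cylinders [MeasurableSpace X] [MeasurableSingletonClass X]
    {P Q : Measure (ℕ → X)} [IsFiniteMeasure P] [IsFiniteMeasure Q]
    (h : ∀ (n : ℕ) (p : ℕ → X), P {ω | ∀ i ≤ n, ω i = p i} = Q {ω | ∀ i ≤ n, ω i = p i}) :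
    P = Q := by
  have key : ∀ n, P.map (Preorder.frestrictLe n) = Q.map (Preorder.frestrictLe n) := by
    intro n
    refine Measure.ext_of_singleton fun q => ?_
    by_cases hX : Nonempty X
    · obtain ⟨x₀⟩ := hX
      have hpre : (Preorder.frestrictLe (π := fun _ => X) n) ⁻¹' {q} =
          {ω | ∀ i ≤ n, ω i =
            (fun j => if hj : j ≤ n then q ⟨j, Finset.mem_Iic.2 hj⟩ else x₀) i} := by
        ext ω
        simp only [Set.mem_preimage, Set.mem_singleton_iff, funext_iff, Set.mem_ofPred_eq]
        constructor
        · intro H i hi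
          simpa [hi] using H ⟨i, Finset.mem_Iic.2 hi⟩
        · rintro H ⟨i, hi⟩
          simpa [Finset.mem_Iic.1 hi] using H i (Finset.mem_Iic.1 hi)
      rw [Measure.map_apply (by fun_prop) (measurableSet_singleton q),
        Measure.map_apply (by fun_prop) (measurableSet_singleton q), hpre, h]
    · exact absurd ⟨q ⟨0, by simp⟩⟩ hX
  refine IsProjectiveLimit.unique (P := fun I => P.map I.restrict) (fun I => rfl) ?_
  refine (isProjectiveLimit_nat_iff (X := fun _ => X)
    (isProjectiveMeasureFamily_map_restrict fun _ => (measurable_pi_apply _).aemeasurable)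
    Q).2 fun n => ?_
  exact (key n).symm

theorem traj_cylinder {X : Type*} [MeasurableSpace X] [MeasurableSingletonClass X] (κ : Kernel X X)
    [IsMarkovKernel κ] (x : X) (p : ℕ → X) (n : ℕ) :
    Kernel.traj (X := fun _ => X)
      (fun n => κ.comap (fun h : (i : Finset.Iic n) → X => h ⟨n, Finset.mem_Iic.2 le_rfl⟩)
        (measurable_pi_apply _)) 0 (fun _ => x) {ω | ∀ i ≤ n, ω i = p i} =
      ({x} : Set X).indicator 1 (p 0) * ∏ i ∈ Finset.range n, κ (p i) {p (i + 1)} := by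
  set K := fun n : ℕ => κ.comap (fun h : (i : Finset.Iic n) → X => h ⟨n, Finset.mem_Iic.2 le_rfl⟩)
    (measurable_pi_apply _)
  have hpre : ∀ n, {ω : ℕ → X | ∀ i ≤ n, ω i = p i} =
      (Preorder.frestrictLe (π := fun _ => X) n) ⁻¹'
        {Preorder.frestrictLe (π := fun _ => X) n p} := by
    intro n
    ext ω
    simp only [Set.mem_preimage, Set.mem_singleton_iff, funext_iff, Set.mem_ofPred_eq]
    exact ⟨fun H i => H i (Finset.mem_Iic.1 i.2), fun H i hi => H ⟨i, Finset.mem_Iic.2 hi⟩⟩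
  have hmarg : ∀ n, Kernel.traj (X := fun _ => X) K 0 (fun _ => x) {ω | ∀ i ≤ n, ω i = p i} =
      Kernel.partialTraj (X := fun _ => X) K 0 n (fun _ => x)
        {Preorder.frestrictLe (π := fun _ => X) n p} := by
    intro n
    rw [hpre, ← Kernel.traj_map_frestrictLe_apply,
      Measure.map_apply (by fun_prop) (measurableSet_singleton _)]
  induction n with
  | zero =>
    rw [hmarg, Kernel.partialTraj_self, Kernel.id_apply, Measure.dirac_apply]
    by_cases h : p 0 = x
    · have : (fun _ : Finset.Iic 0 => x) = Preorder.frestrictLe (π := fun _ => X) 0 p := by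
        funext i
        obtain ⟨i, hi⟩ := i
        have : i = 0 := by simpa using hi
        subst this; exact h.symm
      rw [this]; simp [h]
    · have : (fun _ : Finset.Iic 0 => x) ≠ Preorder.frestrictLe (π := fun _ => X) 0 p := fun H =>
        h (congrFun H ⟨0, by simp⟩).symm
      simp [h, this]
  | succ n ih =>
    have hset : {ω : ℕ → X | ∀ i ≤ n + 1, ω i = p i} =
        (fun ω : ℕ → X => (Preorder.frestrictLe (π := fun _ => X) n ω, ω (n + 1))) ⁻¹'
          ({Preorder.frestrictLe (π := fun _ => X) n p} ×ˢ {p (n + 1)}) := by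
      ext ω
      have := Set.ext_iff.1 (hpre n) ω
      simp only [Set.mem_preimage, Set.mem_prod, Set.mem_singleton_iff, Set.mem_ofPred_eq] at this ⊢
      rw [← this]
      constructor
      · exact fun H => ⟨fun i hi => H i (by omega), H _ le_rfl⟩
      · rintro ⟨H, H'⟩ i hi
        rcases Nat.lt_or_ge n i with h | h
        · obtain rfl : i = n + 1 := by omega
          exact H'
        · exact H i h
    rw [hset, ← Measure.map_apply (by fun_prop)
        ((measurableSet_singleton _).prod (measurableSet_singleton _)),
      ← Kernel.partialTraj_compProd_eq_map_traj (Nat.zero_le n),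
      Measure.compProd_apply_prod (measurableSet_singleton _) (measurableSet_singleton _),
      Measure.restrict_singleton, lintegral_smul_measure, lintegral_dirac, ← hmarg, ih,
      Finset.prod_range_succ, smul_eq_mul, ← mul_assoc]
    rfl

theorem RatDist.toPMF_toMeasure_singleton [MeasurableSpace X] [MeasurableSingletonClass X]
    (d : RatDist X) (x : X) : d.toPMF.toMeasure {x} = ENNReal.ofReal (d.prob x : ℝ) := by
  rw [PMF.toMeasure_apply_singleton _ _ (measurableSet_singleton x)]
  rfl

theorem RatDist.sum_ofReal (d : RatDist X) : ∑ x, ENNReal.ofReal (d.prob x : ℝ) = 1 := by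
  rw [← ENNReal.ofReal_sum_of_nonneg (fun a _ => by exact_mod_cast d.nonneg a),
      ← Rat.cast_sum, d.sum_one]
  simp

instance isProbabilityMeasure_chainLaw (δ : X → RatDist X) (x : X) :
    @IsProbabilityMeasure (ℕ → X) (@MeasurableSpace.pi ℕ (fun _ => X) (fun _ => ⊤))
      (chainLaw δ x) := by
  unfold chainLaw
  infer_instance

theorem chainLaw_cylinder (δ : X → RatDist X) (x : X) (p : ℕ → X) (n : ℕ) :
    chainLaw δ x {ω | ∀ i ≤ n, ω i = p i} =
      ({x} : Set X).indicator 1 (p 0) *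
        ∏ i ∈ Finset.range n, ENNReal.ofReal ((δ (p i)).prob (p (i + 1)) : ℝ) := by
  let _ : MeasurableSpace X := ⊤
  have : IsMarkovKernel (Kernel.ofFunOfCountable fun y => (δ y).toPMF.toMeasure) :=
    ⟨fun y => inferInstanceAs (IsProbabilityMeasure (δ y).toPMF.toMeasure)⟩
  refine (traj_cylinder (Kernel.ofFunOfCountable fun y => (δ y).toPMF.toMeasure) x p n).trans ?_
  congr 1
  refine Finset.prod_congr rfl fun i _ => ?_
  exact (δ (p i)).toPMF_toMeasure_singleton (p (i + 1))

/-- The sequence that starts with `a` and goes on like `ω`. -/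
def consSeq {X : Type*} (a : X) (ω : ℕ → X) : ℕ → X
  | 0 => a
  | n + 1 => ω n

theorem measurableEmbedding_consSeq {X : Type*} [MeasurableSpace X] [MeasurableSingletonClass X]
    (a : X) :
    MeasurableEmbedding (consSeq a : (ℕ → X) → ℕ → X) := by
  refine MeasurableEmbedding.of_measurable_inverse (g := fun ω n => ω (n + 1)) ?_ ?_ ?_ ?_
  · refine measurable_pi_lambda _ fun n => ?_
    cases n with
    | zero => exact measurable_const
    | succ n => exact measurable_pi_apply n
  · have : Set.range (consSeq a : (ℕ → X) → ℕ → X) = (fun ω => ω 0) ⁻¹' {a} := by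
      ext ω
      constructor
      · rintro ⟨ω, rfl⟩; rfl
      · intro h
        refine ⟨fun n => ω (n + 1), ?_⟩
        funext n
        cases n with
        | zero => exact h.symm
        | succ n => rfl
    rw [this]
    exact measurable_pi_apply 0 (measurableSet_singleton a)
  · fun_prop
  · intro ω; rfl

/-- The Markov property at time one. -/
theorem chainLaw_eq_sum (δ : X → RatDist X) (x : X) :
    chainLaw δ x = ∑ y, ENNReal.ofReal ((δ x).prob y : ℝ) •
      @Measure.map _ _ (@MeasurableSpace.pi ℕ (fun _ => X) (fun _ => ⊤))
        (@MeasurableSpace.pi ℕ (fun _ => X) (fun _ => ⊤)) (consSeq x) (chainLaw δ y) := by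
  let _ : MeasurableSpace X := ⊤
  have hemb := measurableEmbedding_consSeq x
  have : IsFiniteMeasure (∑ y, ENNReal.ofReal ((δ x).prob y : ℝ) •
      (chainLaw δ y).map (consSeq x)) := by
    refine ⟨?_⟩
    rw [Measure.finsetSum_apply]
    refine ENNReal.sum_lt_top.2 fun y _ => ?_
    rw [Measure.smul_apply, smul_eq_mul]
    exact ENNReal.mul_lt_top ENNReal.ofReal_lt_top (measure_lt_top _ _)
  refine measure_ext_of_cylinders fun n p => ?_
  rw [chainLaw_cylinder, Measure.finsetSum_apply]
  simp only [Measure.smul_apply, smul_eq_mul, hemb.map_apply]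
  by_cases h : p 0 = x
  · cases n with
    | zero =>
      have : ∀ y, chainLaw δ y (consSeq x ⁻¹' {ω | ∀ i ≤ 0, ω i = p i}) = 1 := by
        intro y
        have : (consSeq x ⁻¹' {ω | ∀ i ≤ 0, ω i = p i}) = Set.univ := by
          ext ω
          simp [consSeq, h]
        rw [this, measure_univ]
      simp only [this, mul_one, RatDist.sum_ofReal]
      simp [h]
    | succ n =>
      have : (consSeq x ⁻¹' {ω | ∀ i ≤ n + 1, ω i = p i}) = {ω | ∀ i ≤ n, ω i = p (i + 1)} := by
        ext ω
        simp only [Set.mem_preimage, Set.mem_ofPred_eq]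
        constructor
        · exact fun H i hi => H (i + 1) (by omega)
        · intro H i hi
          cases i with
          | zero => exact h.symm
          | succ i => exact H i (by omega)
      simp only [this, chainLaw_cylinder δ _ (fun i => p (i + 1))]
      rw [Finset.sum_eq_single (p 1), Finset.prod_range_succ']
      · simp [h, mul_comm]
      · intro y _ hy
        simp [hy.symm]
      · simp
  · have : (consSeq x ⁻¹' {ω | ∀ i ≤ n, ω i = p i}) = ∅ := by
      ext ω
      simp only [Set.mem_preimage, Set.mem_ofPred_eq, Set.mem_empty_iff_false, iff_false]
      exact fun H => h (H 0 (Nat.zero_le n)).symm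
    simp [this, h]

theorem chainLaw_ae_start (δ : X → RatDist X) (x : X) :
    ∀ᵐ ω ∂(chainLaw δ x), ω 0 = x := by
  have h := chainLaw_cylinder δ x (fun _ => x) 0
  let _ : MeasurableSpace X := ⊤
  have hm : MeasurableSet {ω : ℕ → X | ω 0 = x} :=
    measurable_pi_apply (X := fun _ => X) 0 (measurableSet_singleton x)
  rw [ae_iff_prob_eq_one (measurableSet_setOfPred.1 hm)]
  simpa using h

/-- First-step analysis. No measurability of `f` is needed, as prefixing a
state is a measurable embedding. -/
theorem lintegral_chainLaw (δ : X → RatDist X) (x : X) (f : (ℕ → X) → ℝ≥0∞) :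
    ∫⁻ ω, f ω ∂(chainLaw δ x) = ∑ y, ENNReal.ofReal ((δ x).prob y : ℝ) *
      ∫⁻ ω, f (consSeq x ω) ∂(chainLaw δ y) := by
  let _ : MeasurableSpace X := ⊤
  have hemb := measurableEmbedding_consSeq x
  rw [chainLaw_eq_sum, lintegral_finsetSum_measure]
  refine Finset.sum_congr rfl fun y _ => ?_
  rw [lintegral_smul_measure, hemb.lintegral_map, smul_eq_mul]

theorem lintegral_const_add_chainLaw (δ : X → RatDist X) (x : X) (c : ℝ≥0∞)
    (f : (ℕ → X) → ℝ≥0∞) :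
    ∫⁻ ω, c + f ω ∂(chainLaw δ x) = c + ∫⁻ ω, f ω ∂(chainLaw δ x) := by
  let _ : MeasurableSpace X := ⊤
  rw [lintegral_add_left measurable_const, lintegral_const, measure_univ, mul_one]

end Chain

/-! ### Finite distributions -/

namespace RatDist

variable {A B : Type*} [Fintype A] [Fintype B]

open Classical in
/-- The point mass at `a`. -/
noncomputable def dirac (a : A) : RatDist A where
  prob b := if b = a then 1 else 0
  nonneg b := by split_ifs <;> norm_num
  sum_one := by simp

theorem dirac_inSupp {a b : A} : (dirac a).InSupp b ↔ b = a := by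
  unfold InSupp dirac
  by_cases h : b = a <;> simp [h]

theorem exists_inSupp (d : RatDist A) : ∃ a, d.InSupp a := by
  obtain ⟨a, _, h⟩ := Finset.exists_lt_of_sum_lt (s := Finset.univ) (f := fun _ => (0 : ℚ))
    (g := d.prob) (by simp [d.sum_one])
  exact ⟨a, h⟩

/-- The expectation of a nonnegative function. -/
noncomputable def mean (d : RatDist A) (f : A → ℝ≥0∞) : ℝ≥0∞ :=
  ∑ a, ENNReal.ofReal (d.prob a : ℝ) * f a

theorem mean_dirac (a : A) (f : A → ℝ≥0∞) : (dirac a).mean f = f a := by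
  classical
  unfold mean dirac
  rw [Finset.sum_eq_single a] <;> simp +contextual

theorem mean_map (d : RatDist A) (g : A → B) (f : B → ℝ≥0∞) :
    (d.map g).mean f = d.mean (f ∘ g) := by
  classical
  unfold mean map
  rw [← Finset.sum_fiberwise Finset.univ g]
  refine Finset.sum_congr rfl fun b _ => ?_
  rw [Rat.cast_sum, ENNReal.ofReal_sum_of_nonneg (fun a _ => by exact_mod_cast d.nonneg a),
    Finset.sum_mul]
  refine Finset.sum_congr (by ext; simp) fun a ha => ?_
  rw [Function.comp_apply, (Finset.mem_filter.1 ha).2]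

theorem mean_mono (d : RatDist A) {f g : A → ℝ≥0∞} (h : ∀ a, d.InSupp a → f a ≤ g a) :
    d.mean f ≤ d.mean g := by
  refine Finset.sum_le_sum fun a _ => ?_
  rcases (d.nonneg a).eq_or_lt with h0 | h0
  · simp [← h0]
  · gcongr
    exact h a h0

theorem mean_const (d : RatDist A) (c : ℝ≥0∞) : d.mean (fun _ => c) = c := by
  rw [mean, ← Finset.sum_mul, sum_ofReal, one_mul]

theorem le_mean (d : RatDist A) {f : A → ℝ≥0∞} {c : ℝ≥0∞} (h : ∀ a, d.InSupp a → c ≤ f a) :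
    c ≤ d.mean f :=
  (d.mean_const c).symm.le.trans (d.mean_mono h)

end RatDist

/-! ### Truncated sums -/

section TruncatedSum

variable {S : Type*} {G : Game S} {T : Set S}

theorem truncatedSum_of_mem {π : ℕ → S} (h : π 0 ∈ T) : G.truncatedSum T π = 0 := by
  classical
  have hex : ∃ n, π n ∈ T := ⟨0, h⟩
  have h0 : Nat.find hex = 0 := (Nat.find_eq_zero hex).2 h
  rw [Game.truncatedSum, dif_pos hex]
  simp [h0]

theorem truncatedSum_consSeq {s : S} (h : s ∉ T) (π : ℕ → S) :
    G.truncatedSum T (consSeq s π) = G.weight s (π 0) + G.truncatedSum T π := by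
  classical
  by_cases hex : ∃ n, π n ∈ T
  · have hex' : ∃ n, consSeq s π n ∈ T := hex.imp' Nat.succ fun n hn => hn
    have hfind : Nat.find hex' = Nat.find hex + 1 := Nat.find_comp_succ hex' hex h
    rw [Game.truncatedSum, dif_pos hex', Game.truncatedSum, dif_pos hex]
    have := Finset.sum_range_succ' (fun i => G.weight (consSeq s π i) (consSeq s π (i + 1)))
      (Nat.find hex)
    rw [← Nat.cast_add, Nat.cast_inj]
    convert this using 1
    · congr! 2
    · rw [add_comm]
      rfl
  · have hex' : ¬ ∃ n, consSeq s π n ∈ T := by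
      rintro ⟨n, hn⟩
      cases n with
      | zero => exact h hn
      | succ n => exact hex ⟨n, hn⟩
    rw [Game.truncatedSum, dif_neg hex', Game.truncatedSum, dif_neg hex, add_top]

end TruncatedSum

/-! ### First-step analysis of the expected cost -/

section Cost

variable {S : Type*} [Fintype S] {G : Game S} {Mem₁ Mem₂ : Type*}

/-- The distribution of the next state when `s` is visited with memories `m₁` and `m₂`. -/
noncomputable def nextDist (M₁ : MooreMachine G .one Mem₁) (M₂ : MooreMachine G .two Mem₂)
    (s : S) (m₁ : Mem₁) (m₂ : Mem₂) : RatDist S :=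
  match G.owner s with
  | .one => M₁.next m₁ s
  | .two => M₂.next m₂ s

theorem nextDist_of_owner_one {M₁ : MooreMachine G .one Mem₁} {M₂ : MooreMachine G .two Mem₂}
    {s : S} {m₁ : Mem₁} {m₂ : Mem₂} (h : G.owner s = .one) :
    nextDist M₁ M₂ s m₁ m₂ = M₁.next m₁ s := by
  rw [nextDist, h]

theorem nextDist_of_owner_two {M₁ : MooreMachine G .one Mem₁} {M₂ : MooreMachine G .two Mem₂}
    {s : S} {m₁ : Mem₁} {m₂ : Mem₂} (h : G.owner s = .two) :
    nextDist M₁ M₂ s m₁ m₂ = M₂.next m₂ s := by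
  rw [nextDist, h]

/-- The expected truncated sum when the chain `G[M₁, M₂]` starts in an arbitrary state. -/
noncomputable def costFrom [Fintype Mem₁] [Fintype Mem₂] (T : Set S) (M₁ : MooreMachine G .one Mem₁)
    (M₂ : MooreMachine G .two Mem₂) (s : S) (m₁ : Mem₁) (m₂ : Mem₂) : ℝ≥0∞ :=
  ∫⁻ x, (G.truncatedSum T (fun n => (x n).1) : ℝ≥0∞) ∂(chainLaw (productStep M₁ M₂) (s, m₁, m₂))

variable [Fintype Mem₁] [Fintype Mem₂] {T : Set S} {M₁ : MooreMachine G .one Mem₁}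
  {M₂ : MooreMachine G .two Mem₂}
  {s : S} {m₁ : Mem₁} {m₂ : Mem₂}

theorem costFrom_of_mem (h : s ∈ T) : costFrom T M₁ M₂ s m₁ m₂ = 0 := by
  rw [costFrom, ← lintegral_zero]
  refine lintegral_congr_ae ?_
  filter_upwards [chainLaw_ae_start (productStep M₁ M₂) (s, m₁, m₂)] with ω hω
  rw [truncatedSum_of_mem (by simpa [hω] using h)]
  simp

theorem costFrom_of_notMem (h : s ∉ T) : costFrom T M₁ M₂ s m₁ m₂ =
    (nextDist M₁ M₂ s m₁ m₂).mean fun t =>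
      G.weight s t + costFrom T M₁ M₂ t (M₁.update m₁ s) (M₂.update m₂ s) := by
  have hstep : productStep M₁ M₂ (s, m₁, m₂) = (nextDist M₁ M₂ s m₁ m₂).map
      fun t => (t, M₁.update m₁ s, M₂.update m₂ s) := rfl
  have hmean : costFrom T M₁ M₂ s m₁ m₂ = (productStep M₁ M₂ (s, m₁, m₂)).mean
      fun y => G.weight s y.1 + costFrom T M₁ M₂ y.1 y.2.1 y.2.2 := by
    rw [costFrom, lintegral_chainLaw]
    refine Finset.sum_congr rfl fun y _ => ?_
    congr 1
    refine Eq.trans ?_ (lintegral_const_add_chainLaw (productStep M₁ M₂) y _ _)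
    refine lintegral_congr_ae ?_
    filter_upwards [chainLaw_ae_start (productStep M₁ M₂) y] with ω hω
    have : (fun n => (consSeq (s, m₁, m₂) ω n).1) = consSeq s fun n => (ω n).1 := by
      funext n
      cases n <;> rfl
    rw [this, truncatedSum_consSeq h, hω]
    simp
  rw [hmean, hstep, RatDist.mean_map]
  rfl

end Cost

/-! ### The worst case -/

section WorstCase

variable {S : Type*} [Fintype S] {G : Game S} {Mem₁ Mem₂ : Type*}

/-- A play together with the memory contents of the machine `M₁` of player one that it is consistent
with. -/
structure IsRun (M₁ : MooreMachine G .one Mem₁) (π : ℕ → S) (m : ℕ → Mem₁) : Prop where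
  edge : ∀ n, G.edge (π n) (π (n + 1))
  mem : ∀ n, m (n + 1) = M₁.update (m n) (π n)
  supp : ∀ n, G.owner (π n) = .one → (M₁.next (m n) (π n)).InSupp (π (n + 1))

/-- A move allowed by the edges and, in states of player one, by the machine `M₁` in memory
`m`. -/
def Allowed (M₁ : MooreMachine G .one Mem₁) (m : Mem₁) (s t : S) : Prop :=
  G.edge s t ∧ (G.owner s = .one → (M₁.next m s).InSupp t)

/-- Every continuation from `s` with memory `m`, after costs of `k`, has total cost below `μ`. -/
def SafeFrom (T : Set S) (μ : ℕ) (M₁ : MooreMachine G .one Mem₁) (s : S) (m : Mem₁) (k : ℕ) :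
    Prop :=
  ∀ π mem, IsRun M₁ π mem → π 0 = s → mem 0 = m → (k : ℕ∞) + G.truncatedSum T π < μ

variable {T : Set S} {μ : ℕ} {M₁ : MooreMachine G .one Mem₁} {s t : S} {m : Mem₁} {k : ℕ}

theorem exists_allowed (M₁ : MooreMachine G .one Mem₁) (m : Mem₁) (s : S) :
    ∃ t, Allowed M₁ m s t := by
  by_cases h : G.owner s = .one
  · obtain ⟨t, ht⟩ := (M₁.next m s).exists_inSupp
    exact ⟨t, M₁.supp m s h t ht, fun _ => ht⟩
  · obtain ⟨t, ht⟩ := G.nonblocking s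
    exact ⟨t, ht, fun h' => absurd h' h⟩

theorem exists_isRun (M₁ : MooreMachine G .one Mem₁) (m : Mem₁) (s : S) :
    ∃ π mem, IsRun M₁ π mem ∧ π 0 = s ∧ mem 0 = m := by
  choose f hf using exists_allowed M₁
  let step : S × Mem₁ → S × Mem₁ := fun x => (f x.2 x.1, M₁.update x.2 x.1)
  have hs : ∀ n, step^[n + 1] (s, m) = step (step^[n] (s, m)) := fun n =>
    Function.iterate_succ_apply' step n (s, m)
  refine ⟨fun n => (step^[n] (s, m)).1, fun n => (step^[n] (s, m)).2, ⟨?_, ?_, ?_⟩, rfl, rfl⟩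
  · intro n
    simp only [hs]
    exact (hf _ _).1
  · intro n
    simp only [hs]
    rfl
  · intro n hn
    simp only [hs]
    exact (hf _ _).2 hn

theorem SafeFrom.lt (h : SafeFrom T μ M₁ s m k) : k < μ := by
  obtain ⟨π, mem, hr, h0, h1⟩ := exists_isRun M₁ m s
  exact_mod_cast lt_of_le_of_lt le_self_add (h π mem hr h0 h1)

theorem SafeFrom.step (h : SafeFrom T μ M₁ s m k) (hs : s ∉ T) (ht : Allowed M₁ m s t) :
    SafeFrom T μ M₁ t (M₁.update m s) (k + G.weight s t) := by
  rintro π mem hr rfl h1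
  have := h (consSeq s π) (consSeq m mem) ⟨?_, ?_, ?_⟩ rfl rfl
  · rw [truncatedSum_consSeq hs, ← add_assoc] at this
    exact_mod_cast this
  · rintro (_ | n)
    exacts [ht.1, hr.edge n]
  · rintro (_ | n)
    exacts [h1, hr.mem n]
  · rintro (_ | n)
    exacts [ht.2, hr.supp n]

theorem Allowed.weight_pos (ht : Allowed M₁ m s t) : 0 < G.weight s t :=
  G.weight_pos _ _ ht.1

/-- The worst-case requirement, when started in state `s` with memory `m`, holds if an invariant
bounds the costs until the target is reached. -/
theorem safeFrom_of_invariant (Inv : S → Mem₁ → ℕ → Prop)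
    (hlt : ∀ s m k, Inv s m k → k < μ)
    (hstep : ∀ s m k t, Inv s m k → s ∉ T → Allowed M₁ m s t →
      Inv t (M₁.update m s) (k + G.weight s t)) :
    Inv s m k → SafeFrom T μ M₁ s m k := by
  -- Weights are positive, so that `μ - k` decreases in every step.
  induction hd : μ - k using Nat.strong_induction_on generalizing s m k with
  | _ d ih =>
    rintro hInv π mem hr rfl rfl
    have hk := hlt _ _ _ hInv
    by_cases hT : π 0 ∈ T
    · rw [truncatedSum_of_mem hT]
      exact_mod_cast hk
    · have hall : Allowed M₁ (mem 0) (π 0) (π 1) := ⟨hr.edge 0, hr.supp 0⟩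
      have hw := hall.weight_pos
      have := ih (μ - (k + G.weight (π 0) (π 1))) (by omega) rfl (hstep _ _ _ _ hInv hT hall)
        (fun n => π (n + 1)) (fun n => mem (n + 1))
        ⟨fun n => hr.edge _, fun n => hr.mem _, fun n => hr.supp _⟩ rfl (hr.mem 0)
      have hcons : π = consSeq (π 0) (fun n => π (n + 1)) := by
        funext n
        cases n <;> rfl
      rw [hcons, truncatedSum_consSeq hT, ← add_assoc]
      exact_mod_cast this

open Classical in
/-- The strategy that picks uniformly among all successors: every play is consistent with it. -/
noncomputable def uniformStrategy (G : Game S) (i : Player) : Strategy G i where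
  act _ s :=
    { prob := fun t => if G.edge s t then 1 / ((Finset.univ.filter (G.edge s)).card : ℚ) else 0
      nonneg := fun t => by split_ifs <;> positivity
      sum_one := by
        have : (Finset.univ.filter (G.edge s)).card ≠ 0 := by
          obtain ⟨t, ht⟩ := G.nonblocking s
          exact Finset.card_ne_zero_of_mem (Finset.mem_filter.2 ⟨Finset.mem_univ t, ht⟩)
        rw [← Finset.sum_filter, Finset.sum_const, nsmul_eq_mul]
        field_simp }
  supp _ s _ _ t ht := by
    by_contra h
    simp [RatDist.InSupp, h] at ht

theorem uniformStrategy_consistent {i : Player} {π : ℕ → S}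
    (h : ∀ n, G.edge (π n) (π (n + 1))) : (uniformStrategy G i).Consistent π := by
  classical
  intro n _
  have : 0 < (Finset.univ.filter (G.edge (π n))).card :=
    Finset.card_pos.2 ⟨_, Finset.mem_filter.2 ⟨Finset.mem_univ _, h n⟩⟩
  simp only [RatDist.InSupp, uniformStrategy, h n, if_true]
  positivity

/-- The worst-case requirement on outcomes is safety from the start. -/
theorem forall_outcomes_iff_safeFrom (M₁ : MooreMachine G .one Mem₁) (s₀ : S) :
    (∀ σ₂ : Strategy G .two, ∀ π ∈ G.outcomes s₀ M₁.toStrategy σ₂,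
      G.truncatedSum T π < (μ : ℕ∞)) ↔ SafeFrom T μ M₁ s₀ M₁.init 0 := by
  constructor
  · rintro h π mem hr rfl h1
    rw [Nat.cast_zero, zero_add]
    refine h (uniformStrategy G .two) π ⟨rfl, hr.edge, ?_, uniformStrategy_consistent hr.edge⟩
    have hmem : ∀ n, ((List.range n).map π).foldl M₁.update M₁.init = mem n := by
      intro n
      induction n with
      | zero => exact h1.symm
      | succ n ih => rw [List.range_succ, List.map_append, List.foldl_append, ih, hr.mem]; rfl
    intro n hn
    change (M₁.next _ _).InSupp _
    rw [hmem]
    exact hr.supp n hn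
  · rintro h σ₂ π ⟨h0, hedge, hcons, -⟩
    have := h π (fun n => ((List.range n).map π).foldl M₁.update M₁.init)
      ⟨hedge, fun n => ?_, hcons⟩ h0 rfl
    · simpa using this
    · simp [List.range_succ]

theorem satisfies_iff [Fintype Mem₁] [Fintype Mem₂] {M₂ : MooreMachine G .two Mem₂} {s₀ : S}
    {ν : ℚ} : Satisfies s₀ T M₂ μ ν M₁ ↔
      SafeFrom T μ M₁ s₀ M₁.init 0 ∧
        costFrom T M₁ M₂ s₀ M₁.init M₂.init < ENNReal.ofReal (ν : ℝ) :=
  and_congr_left' (forall_outcomes_iff_safeFrom M₁ s₀)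

end WorstCase

/-! ### The winning region of the unfolded product -/

section UnfoldedProduct

variable {S : Type*} [Fintype S] {G : Game S} {Mem₂ : Type*} {μ : ℕ} {T : Set S}
  {M₂ : MooreMachine G .two Mem₂}

/-- The distance of a counter value to `μ`, which is zero for the value of overflow. -/
def Counter.slack : Counter μ → ℕ
  | none => 0
  | some v => μ - v

theorem Counter.slack_add_lt {u : Counter μ} {c : ℕ} (hu : u ≠ none) (hc : 0 < c) :
    (u.add c).slack < u.slack := by
  obtain ⟨v, rfl⟩ := Option.ne_none_iff_exists'.1 hu
  have hv := v.2
  change (Counter.ofNat μ (v + c)).slack < μ - v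
  unfold Counter.ofNat
  split_ifs
  · change μ - (v + c) < μ - v
    omega
  · change 0 < μ - (v : ℕ)
    omega

theorem Counter.ofNat_add (k c : ℕ) :
    (Counter.ofNat μ k).add c = Counter.ofNat μ (k + c) := by
  unfold Counter.ofNat
  split_ifs with h h' h'
  · simp [Counter.add, Counter.ofNat, h']
  · simp [Counter.add, Counter.ofNat, h']
  · omega
  · rfl

theorem Counter.ofNat_ne_none {k : ℕ} (h : k < μ) : Counter.ofNat μ k ≠ none := by
  simp [Counter.ofNat, h]

/-- The successor of a state of the unfolded product in the direction of a state `t` of `G`. -/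
def unfoldedSucc (M₂ : MooreMachine G .two Mem₂) (x : S × Counter μ × Mem₂) (t : S) :
    S × Counter μ × Mem₂ :=
  (t, x.2.1.add (G.weight x.1 t), M₂.update x.2.2 x.1)

theorem edge_unfoldedSucc {x : S × Counter μ × Mem₂} {t : S} (h : G.edge x.1 t) :
    (unfoldedProduct M₂ μ).edge x (unfoldedSucc M₂ x t) := ⟨h, rfl, rfl⟩

theorem eq_unfoldedSucc_of_edge {x y : S × Counter μ × Mem₂}
    (h : (unfoldedProduct M₂ μ).edge x y) : y = unfoldedSucc M₂ x y.1 :=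
  Prod.ext rfl (Prod.ext h.2.1 h.2.2)

variable [Fintype Mem₂]

/-- A state with an exhausted counter is lost. -/
theorem ne_none_of_mem_winningRegion {x : S × Counter μ × Mem₂} (h : x ∈ winningRegion T M₂ μ) :
    x.2.1 ≠ none := by
  change (unfoldedProduct M₂ μ).Attr (unfoldedTarget T μ Mem₂) x at h
  have hnone : ∀ {y z : S × Counter μ × Mem₂}, (unfoldedProduct M₂ μ).edge y z →
      z.2.1 ≠ none → y.2.1 ≠ none := by
    intro y z hyz hz hy
    rw [hyz.2.1, hy] at hz
    exact hz rfl
  induction h with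
  | base x hx => exact hx.2
  | one x y _ hxy h ih => exact hnone hxy ih
  | two x _ h ih =>
    obtain ⟨y, hy⟩ := (unfoldedProduct M₂ μ).nonblocking x
    exact hnone hy (ih y hy)

theorem exists_succ_mem_winningRegion {x : S × Counter μ × Mem₂} (h : x ∈ winningRegion T M₂ μ)
    (hT : x ∉ unfoldedTarget T μ Mem₂) (ho : G.owner x.1 = .one) :
    ∃ t, G.edge x.1 t ∧ unfoldedSucc M₂ x t ∈ winningRegion T M₂ μ := by
  cases h with
  | base _ h => exact absurd h hT
  | one _ y _ hxy h => exact ⟨y.1, hxy.1, eq_unfoldedSucc_of_edge hxy ▸ h⟩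
  | two _ h _ => exact absurd (ho.symm.trans h) (by simp)

theorem succ_mem_winningRegion {x : S × Counter μ × Mem₂} (h : x ∈ winningRegion T M₂ μ)
    (hT : x ∉ unfoldedTarget T μ Mem₂) (ho : G.owner x.1 = .two) {t : S} (ht : G.edge x.1 t) :
    unfoldedSucc M₂ x t ∈ winningRegion T M₂ μ := by
  cases h with
  | base _ h => exact absurd h hT
  | one _ y h _ _ => exact absurd (ho.symm.trans h) (by simp)
  | two _ _ h => exact h _ (edge_unfoldedSucc ht)

/-! ### The optimal value in the unfolded product -/

open Classical in
/-- The Bellman operator of the shortest-path problem on the winning region of the unfolded product,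
with player two played by `M₂`. -/
noncomputable def bellman (T : Set S) (M₂ : MooreMachine G .two Mem₂) (μ : ℕ) :
    (S × Counter μ × Mem₂ → ℝ≥0∞) →o (S × Counter μ × Mem₂ → ℝ≥0∞) where
  toFun V x :=
    if x ∈ unfoldedTarget T μ Mem₂ then 0
    else match G.owner x.1 with
      | .one => ⨅ t, ⨅ _ : G.edge x.1 t ∧ unfoldedSucc M₂ x t ∈ winningRegion T M₂ μ,
          (G.weight x.1 t + V (unfoldedSucc M₂ x t) : ℝ≥0∞)
      | .two => (M₂.next x.2.2 x.1).mean fun t => G.weight x.1 t + V (unfoldedSucc M₂ x t)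
  monotone' V W hVW x := by
    dsimp only
    split_ifs
    · exact le_rfl
    · cases G.owner x.1 with
      | one => exact iInf_mono fun t => iInf_mono fun _ => by gcongr; exact hVW _
      | two => exact RatDist.mean_mono _ fun t _ => by gcongr; exact hVW _

/-- The optimal value of the shortest-path problem on the winning region, as the least solution of
the Bellman equation. -/
noncomputable def optimalValue (T : Set S) (M₂ : MooreMachine G .two Mem₂) (μ : ℕ) :
    S × Counter μ × Mem₂ → ℝ≥0∞ :=
  (bellman T M₂ μ).lfp

theorem optimalValue_eq (T : Set S) (M₂ : MooreMachine G .two Mem₂) (x : S × Counter μ × Mem₂) :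
    optimalValue T M₂ μ x = bellman T M₂ μ (optimalValue T M₂ μ) x :=
  congrFun (bellman T M₂ μ).map_lfp.symm x

theorem optimalValue_of_mem {x : S × Counter μ × Mem₂} (h : x ∈ unfoldedTarget T μ Mem₂) :
    optimalValue T M₂ μ x = 0 := by
  rw [optimalValue_eq]
  exact if_pos h

theorem optimalValue_one {x : S × Counter μ × Mem₂} (h : x ∉ unfoldedTarget T μ Mem₂)
    (ho : G.owner x.1 = .one) : optimalValue T M₂ μ x =
      ⨅ t, ⨅ _ : G.edge x.1 t ∧ unfoldedSucc M₂ x t ∈ winningRegion T M₂ μ,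
          (G.weight x.1 t + optimalValue T M₂ μ (unfoldedSucc M₂ x t) : ℝ≥0∞) := by
  rw [optimalValue_eq]
  refine (if_neg h).trans ?_
  rw [ho]

theorem optimalValue_two {x : S × Counter μ × Mem₂} (h : x ∉ unfoldedTarget T μ Mem₂)
    (ho : G.owner x.1 = .two) : optimalValue T M₂ μ x =
      (M₂.next x.2.2 x.1).mean fun t =>
        G.weight x.1 t + optimalValue T M₂ μ (unfoldedSucc M₂ x t) := by
  rw [optimalValue_eq]
  refine (if_neg h).trans ?_
  rw [ho]

/-- In states of player one in the winning region the infimum of the Bellman equation is attained.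
The statement covers all states, so that a strategy can be chosen from it. -/
theorem exists_optimal_succ (T : Set S) (M₂ : MooreMachine G .two Mem₂)
    (x : S × Counter μ × Mem₂) :
    ∃ t, G.edge x.1 t ∧ (x ∈ winningRegion T M₂ μ → x ∉ unfoldedTarget T μ Mem₂ →
      G.owner x.1 = .one → unfoldedSucc M₂ x t ∈ winningRegion T M₂ μ ∧
        G.weight x.1 t + optimalValue T M₂ μ (unfoldedSucc M₂ x t) ≤ optimalValue T M₂ μ x) := by
  by_cases h : x ∈ winningRegion T M₂ μ ∧ x ∉ unfoldedTarget T μ Mem₂ ∧ G.owner x.1 = .one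
  · obtain ⟨h, hT, ho⟩ := h
    obtain ⟨t, ht, hmin⟩ := Set.exists_min_image
      {t | G.edge x.1 t ∧ unfoldedSucc M₂ x t ∈ winningRegion T M₂ μ}
      (fun t => (G.weight x.1 t + optimalValue T M₂ μ (unfoldedSucc M₂ x t) : ℝ≥0∞))
      (Set.toFinite _) (exists_succ_mem_winningRegion h hT ho)
    refine ⟨t, ht.1, fun _ _ _ => ⟨ht.2, ?_⟩⟩
    rw [optimalValue_one hT ho]
    exact le_iInf₂ hmin
  · obtain ⟨t, ht⟩ := G.nonblocking x.1
    exact ⟨t, ht, fun h1 h2 h3 => absurd ⟨h1, h2, h3⟩ h⟩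

/-- A successor that attains the infimum of the Bellman equation in states of player one in the
winning region before the target, and an arbitrary successor elsewhere. -/
noncomputable def optimalSucc (T : Set S) (M₂ : MooreMachine G .two Mem₂)
    (x : S × Counter μ × Mem₂) : S :=
  (exists_optimal_succ T M₂ x).choose

theorem edge_optimalSucc (x : S × Counter μ × Mem₂) : G.edge x.1 (optimalSucc T M₂ x) :=
  (exists_optimal_succ T M₂ x).choose_spec.1

theorem optimalSucc_spec {x : S × Counter μ × Mem₂} (h : x ∈ winningRegion T M₂ μ)
    (hT : x ∉ unfoldedTarget T μ Mem₂) (ho : G.owner x.1 = .one) :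
    unfoldedSucc M₂ x (optimalSucc T M₂ x) ∈ winningRegion T M₂ μ ∧
      G.weight x.1 (optimalSucc T M₂ x) +
        optimalValue T M₂ μ (unfoldedSucc M₂ x (optimalSucc T M₂ x)) ≤ optimalValue T M₂ μ x :=
  (exists_optimal_succ T M₂ x).choose_spec.2 h hT ho

/-- The memoryless strategy that always moves to an optimal successor. -/
noncomputable def optimalStrategy (T : Set S) (M₂ : MooreMachine G .two Mem₂) (μ : ℕ) :
    MooreMachine (unfoldedProduct M₂ μ) .one Unit where
  init := ()
  update _ _ := ()
  next _ x := RatDist.dirac (unfoldedSucc M₂ x (optimalSucc T M₂ x))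
  supp _ x _ y hy := by
    rw [RatDist.dirac_inSupp.1 hy]
    exact edge_unfoldedSucc (edge_optimalSucc x)

theorem optimalStrategy_stays : StaysInWinningRegion T M₂ μ (optimalStrategy T M₂ μ) := by
  intro x hx hT ho y hy
  rw [RatDist.dirac_inSupp.1 hy]
  exact (optimalSucc_spec hx hT ho).1

/-! ### Comparison with the optimal value -/

theorem SafeFrom.mem_winningRegion {Mem₁ : Type*} {M₁ : MooreMachine G .one Mem₁} {s : S}
    {m₁ : Mem₁} {k : ℕ} (m₂ : Mem₂) (h : SafeFrom T μ M₁ s m₁ k) :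
    (s, Counter.ofNat μ k, m₂) ∈ winningRegion T M₂ μ := by
  induction hd : μ - k using Nat.strong_induction_on generalizing s m₁ k m₂ with
  | _ d ih =>
    have hk := h.lt
    by_cases hT : s ∈ T
    · exact .base _ ⟨hT, Counter.ofNat_ne_none hk⟩
    · have hall : ∀ t, Allowed M₁ m₁ s t → unfoldedSucc M₂ (s, Counter.ofNat μ k, m₂) t ∈
          winningRegion T M₂ μ := by
        intro t ht
        have hw := ht.weight_pos
        have := ih (μ - (k + G.weight s t)) (by omega) (M₂.update m₂ s) (h.step hT ht) rfl
        rwa [← Counter.ofNat_add] at this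
      cases ho : G.owner s with
      | one =>
        obtain ⟨t, ht⟩ := exists_allowed M₁ m₁ s
        exact .one _ _ ho (edge_unfoldedSucc ht.1) (hall t ht)
      | two =>
        refine .two _ ho fun y hy => ?_
        rw [eq_unfoldedSucc_of_edge hy]
        exact hall _ ⟨hy.1, fun h => absurd (ho.symm.trans h) (by simp)⟩

/-- No safe machine beats the optimal value: its moves are among those over which the Bellman
equation minimizes. -/
theorem SafeFrom.optimalValue_le_costFrom {Mem₁ : Type*} [Fintype Mem₁]
    {M₁ : MooreMachine G .one Mem₁} {s : S} {m₁ : Mem₁} {k : ℕ} (m₂ : Mem₂)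
    (h : SafeFrom T μ M₁ s m₁ k) :
    optimalValue T M₂ μ (s, Counter.ofNat μ k, m₂) ≤ costFrom T M₁ M₂ s m₁ m₂ := by
  induction hd : μ - k using Nat.strong_induction_on generalizing s m₁ k m₂ with
  | _ d ih =>
    have hk := h.lt
    by_cases hT : s ∈ T
    · rw [optimalValue_of_mem ⟨hT, Counter.ofNat_ne_none hk⟩]
      exact zero_le
    · have hT' : (s, Counter.ofNat μ k, m₂) ∉ unfoldedTarget T μ Mem₂ := fun h => hT h.1
      have hall : ∀ t, Allowed M₁ m₁ s t →
          optimalValue T M₂ μ (unfoldedSucc M₂ (s, Counter.ofNat μ k, m₂) t) ≤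
            costFrom T M₁ M₂ t (M₁.update m₁ s) (M₂.update m₂ s) := by
        intro t ht
        have hw := ht.weight_pos
        have := ih (μ - (k + G.weight s t)) (by omega) (M₂.update m₂ s) (h.step hT ht) rfl
        rwa [← Counter.ofNat_add] at this
      rw [costFrom_of_notMem hT]
      cases ho : G.owner s with
      | one =>
        rw [optimalValue_one hT' ho, nextDist_of_owner_one ho]
        refine RatDist.le_mean _ fun t ht => ?_
        have hat : Allowed M₁ m₁ s t := ⟨M₁.supp _ _ ho t ht, fun _ => ht⟩
        have hwin := (h.step hT hat).mem_winningRegion (M₂ := M₂) (M₂.update m₂ s)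
        rw [← Counter.ofNat_add] at hwin
        refine (iInf₂_le t ⟨hat.1, hwin⟩).trans ?_
        gcongr
        exact hall t hat
      | two =>
        rw [optimalValue_two hT' ho, nextDist_of_owner_two ho]
        refine RatDist.mean_mono _ fun t ht => ?_
        gcongr
        exact hall t ⟨M₂.supp _ _ ho t ht, fun h => absurd (ho.symm.trans h) (by simp)⟩

/-- In the winning region, playing the optimal strategy costs no more than the optimal value,
whatever the memory, as long as it encodes the right running sum. -/
theorem costFrom_translateBack_le {s : S} {o : Option S} {u : Counter μ} {m : Mem₂}
    (h : (s, currentSum G o u s, m) ∈ winningRegion T M₂ μ) :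
    costFrom T (translateBack M₂ μ (optimalStrategy T M₂ μ)) M₂ s (o, u, m) m ≤
      optimalValue T M₂ μ (s, currentSum G o u s, m) := by
  induction hd : (currentSum G o u s).slack using Nat.strong_induction_on
    generalizing s o u m with
  | _ d ih =>
    have hu : currentSum G o u s ≠ none := ne_none_of_mem_winningRegion h
    by_cases hT : s ∈ T
    · rw [costFrom_of_mem hT]
      exact zero_le
    · have hT' : (s, currentSum G o u s, m) ∉ unfoldedTarget T μ Mem₂ := fun h => hT h.1
      have hall : ∀ t, G.edge s t →
          unfoldedSucc M₂ (s, currentSum G o u s, m) t ∈ winningRegion T M₂ μ →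
          costFrom T (translateBack M₂ μ (optimalStrategy T M₂ μ)) M₂ t
              (some s, currentSum G o u s, M₂.update m s) (M₂.update m s) ≤
            optimalValue T M₂ μ (unfoldedSucc M₂ (s, currentSum G o u s, m) t) := by
        intro t ht hwin
        exact ih _ (hd ▸ Counter.slack_add_lt hu (G.weight_pos s t ht))
          (o := some s) (u := currentSum G o u s) hwin rfl
      rw [costFrom_of_notMem hT]
      cases ho : G.owner s with
      | one =>
        obtain ⟨hwin, hle⟩ := optimalSucc_spec h hT' ho
        have hnext : nextDist (translateBack M₂ μ (optimalStrategy T M₂ μ)) M₂ s (o, u, m) m =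
            (RatDist.dirac (unfoldedSucc M₂ (s, currentSum G o u s, m)
              (optimalSucc T M₂ (s, currentSum G o u s, m)))).map Prod.fst :=
          nextDist_of_owner_one ho
        rw [hnext, RatDist.mean_map, RatDist.mean_dirac]
        refine le_trans ?_ hle
        exact add_le_add_right (hall _ (edge_optimalSucc (s, currentSum G o u s, m)) hwin) _
      | two =>
        rw [optimalValue_two hT' ho, nextDist_of_owner_two ho]
        refine RatDist.mean_mono _ fun t ht => ?_
        have hedge := M₂.supp _ _ ho t ht
        exact add_le_add_right (hall t hedge (succ_mem_winningRegion h hT' ho hedge)) _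

theorem safeFrom_translateBack {σ : MooreMachine (unfoldedProduct M₂ μ) .one Unit}
    (hσ : StaysInWinningRegion T M₂ μ σ) {s₀ : S}
    (h : (s₀, Counter.ofNat μ 0, M₂.init) ∈ winningRegion T M₂ μ) :
    SafeFrom T μ (translateBack M₂ μ σ) s₀ (translateBack M₂ μ σ).init 0 := by
  refine safeFrom_of_invariant (fun s m k => currentSum G m.1 m.2.1 s = Counter.ofNat μ k ∧
    (s, Counter.ofNat μ k, m.2.2) ∈ winningRegion T M₂ μ) ?_ ?_ ⟨rfl, h⟩
  · rintro s m k ⟨-, hwin⟩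
    by_contra hk
    exact ne_none_of_mem_winningRegion hwin (by simp [Counter.ofNat, hk])
  · rintro s ⟨o, u, m⟩ k t ⟨hsum, hwin⟩ hT ⟨hedge, hsupp⟩
    have hsum' : currentSum G o u s = Counter.ofNat μ k := hsum
    refine ⟨?_, ?_⟩
    · change (currentSum G o u s).add _ = _
      rw [hsum', Counter.ofNat_add]
    · have hT' : (s, Counter.ofNat μ k, m) ∉ unfoldedTarget T μ Mem₂ := fun h => hT h.1
      have : unfoldedSucc M₂ (s, Counter.ofNat μ k, m) t ∈ winningRegion T M₂ μ := by
        cases ho : G.owner s with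
        | one =>
          obtain ⟨y, rfl, hy⟩ := RatDist.exists_of_map_inSupp (hsupp ho)
          change (σ.next () (s, currentSum G o u s, m)).InSupp y at hy
          rw [hsum'] at hy
          rw [← eq_unfoldedSucc_of_edge (σ.supp _ (s, Counter.ofNat μ k, m) ho _ hy)]
          exact hσ _ hwin hT' ho y hy
        | two => exact succ_mem_winningRegion hwin hT' ho hedge
      rw [unfoldedSucc, Counter.ofNat_add] at this
      exact this

theorem Satisfies.translateBack {Mem₁ : Type*} [Fintype Mem₁] {M₁ : MooreMachine G .one Mem₁}
    {s₀ : S} {ν : ℚ} (h : Satisfies s₀ T M₂ μ ν M₁) :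
    Satisfies s₀ T M₂ μ ν (translateBack M₂ μ (optimalStrategy T M₂ μ)) := by
  obtain ⟨hsafe, hcost⟩ := satisfies_iff.1 h
  have hwin := hsafe.mem_winningRegion (M₂ := M₂) M₂.init
  exact satisfies_iff.2 ⟨safeFrom_translateBack optimalStrategy_stays hwin,
    ((costFrom_translateBack_le (o := none) hwin).trans
      (hsafe.optimalValue_le_costFrom _)).trans_lt hcost⟩

theorem card_unfoldedMemory (S : Type*) [Fintype S] (μ : ℕ) (Mem₂ : Type*) [Fintype Mem₂] :
    Fintype.card (UnfoldedMemory S μ Mem₂) =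
      (Fintype.card S + 1) * (μ + 1) * Fintype.card Mem₂ := by
  simp [mul_assoc]

end UnfoldedProduct

/-! ### Expected costs in the three-state family -/

section Family

variable {k μ : ℕ} {hμ : 2 ≤ μ} {Mem₁ : Type*}

theorem mean_uniformS₁S₃ (f : Three → ℝ≥0∞) :
    uniformS₁S₃.mean f = 2⁻¹ * f .s₁ + 2⁻¹ * f .s₃ := by
  have huniv : (Finset.univ : Finset Three) = {.s₁, .s₂, .s₃} := rfl
  rw [RatDist.mean, huniv, Finset.sum_insert (by decide), Finset.sum_insert (by decide),
    Finset.sum_singleton]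
  change ENNReal.ofReal ((1 / 2 : ℚ) : ℝ) * _ + (ENNReal.ofReal ((0 : ℚ) : ℝ) * _ +
    ENNReal.ofReal ((1 / 2 : ℚ) : ℝ) * _) = _
  simp

/-- The expected cost of moving from `s₁` to `s₂`, in terms of the expected cost after the return
to `s₁`. -/
theorem costFrom_familyGame_s₂ [Fintype Mem₁] (M₁ : MooreMachine (familyGame μ hμ) .one Mem₁)
    (m : Mem₁) :
    1 + costFrom {.s₃} M₁ (familyModel μ hμ) .s₂ m () =
      2 + costFrom {.s₃} M₁ (familyModel μ hμ) .s₁ (M₁.update m .s₂) () / 2 := by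
  rw [costFrom_of_notMem (by simp), nextDist_of_owner_two rfl]
  change 1 + uniformS₁S₃.mean _ = _
  rw [mean_uniformS₁S₃, costFrom_of_mem (Set.mem_singleton _)]
  change 1 + (2⁻¹ * (((1 : ℕ) : ℝ≥0∞) + costFrom {.s₃} M₁ (familyModel μ hμ) .s₁
    (M₁.update m .s₂) ()) + 2⁻¹ * (((1 : ℕ) : ℝ≥0∞) + 0)) = _
  rw [Nat.cast_one, add_zero, mul_add, mul_one, add_right_comm, ENNReal.inv_two_add_inv_two,
    ← add_assoc, one_add_one_eq_two, div_eq_mul_inv, mul_comm]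

theorem costFrom_familyGame_s₁ [Fintype Mem₁] (M₁ : MooreMachine (familyGame μ hμ) .one Mem₁)
    (m : Mem₁) : costFrom {.s₃} M₁ (familyModel μ hμ) .s₁ m () =
      (M₁.next m .s₁).mean fun t => (familyGame μ hμ).weight .s₁ t +
        costFrom {.s₃} M₁ (familyModel μ hμ) t (M₁.update m .s₁) () := by
  rw [costFrom_of_notMem (by simp), nextDist_of_owner_one rfl]

/-- The expected cost of the strategy that moves `i` times from `s₁` to `s₂` and then to `s₃`. -/
def loopValue (k i : ℕ) : ℚ := 4 + (2 * k + 2) / 2 ^ i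

theorem loopValue_zero : loopValue k 0 = 2 * k + 6 := by
  unfold loopValue
  ring

theorem loopValue_anti {i j : ℕ} (h : i ≤ j) : loopValue k j ≤ loopValue k i := by
  unfold loopValue
  gcongr
  norm_num

theorem loopValue_succ_lt (i : ℕ) : loopValue k (i + 1) < loopValue k i := by
  unfold loopValue
  gcongr <;> simp

theorem ofReal_loopValue_succ (i : ℕ) :
    2 + ENNReal.ofReal (loopValue k i : ℝ) / 2 = ENNReal.ofReal (loopValue k (i + 1) : ℝ) := by
  have hpos : (0 : ℝ) ≤ (loopValue k i : ℝ) := by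
    exact_mod_cast (by unfold loopValue; positivity : (0 : ℚ) ≤ loopValue k i)
  rw [← ENNReal.ofReal_ofNat 2, ← ENNReal.ofReal_div_of_pos (by norm_num),
    ← ENNReal.ofReal_add (by norm_num) (by positivity)]
  congr 1
  simp only [loopValue]
  push_cast
  rw [pow_succ]
  ring

theorem ofReal_loopValue_zero (h : μ = 13 + 4 * k) :
    ENNReal.ofReal (loopValue k 0 : ℝ) = ((μ / 2 : ℕ) : ℝ≥0∞) := by
  have : μ / 2 = 2 * k + 6 := by omega
  rw [loopValue_zero, this, ← ENNReal.ofReal_natCast]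
  push_cast
  rfl

/-! ### A machine that loops as often as the worst case permits -/

/-- The machine that counts its visits of `s₁` and moves to `s₃` at visit `k + 4`, that is, after
`k + 3` loops. -/
noncomputable def countingMachine (k μ : ℕ) (hμ : 2 ≤ μ) :
    MooreMachine (familyGame μ hμ) .one (Fin (k + 4)) where
  init := 0
  update m
    | .s₁ => if h : (m : ℕ) + 1 < k + 4 then ⟨m + 1, h⟩ else m
    | _ => m
  next m
    | .s₁ => if (m : ℕ) = k + 3 then RatDist.dirac .s₃ else RatDist.dirac .s₂
    | _ => RatDist.dirac .s₃
  supp m s ho t ht := by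
    cases s with
    | s₁ =>
      dsimp only at ht
      split_ifs at ht
      · exact Or.inr (RatDist.dirac_inSupp.1 ht)
      · exact Or.inl (RatDist.dirac_inSupp.1 ht)
    | s₂ => exact Player.noConfusion ho
    | s₃ => exact RatDist.dirac_inSupp.1 ht

theorem countingMachine_update_s₁ {m : Fin (k + 4)} (h : (m : ℕ) + 1 < k + 4) :
    (countingMachine k μ hμ).update m .s₁ = ⟨m + 1, h⟩ := dif_pos h

theorem countingMachine_next_lt {m : Fin (k + 4)} (h : (m : ℕ) + 1 < k + 4) :
    (countingMachine k μ hμ).next m .s₁ = RatDist.dirac .s₂ := if_neg (by omega)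

theorem countingMachine_next_last {m : Fin (k + 4)} (h : (m : ℕ) = k + 3) :
    (countingMachine k μ hμ).next m .s₁ = RatDist.dirac .s₃ := if_pos h

theorem safeFrom_countingMachine (h : μ = 13 + 4 * k) :
    SafeFrom {.s₃} μ (countingMachine k μ hμ) .s₁ (countingMachine k μ hμ).init 0 := by
  -- Before visit `m` of `s₁`, where visits are counted from zero, the cost is `2 * m`.
  refine safeFrom_of_invariant (fun s m c => match s with
    | .s₁ => c = 2 * (m : ℕ)
    | .s₂ => c + 1 = 2 * (m : ℕ)
    | .s₃ => c < μ) ?_ ?_ rfl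
  · rintro (_ | _ | _) m c hc
    · have := m.2
      dsimp only at hc
      omega
    · have := m.2
      dsimp only at hc
      omega
    · exact hc
  · rintro (_ | _ | _) m c t hc hs ⟨hedge, hsupp⟩
    · dsimp only at hc
      have hsupp := hsupp rfl
      rcases Nat.lt_or_ge ((m : ℕ) + 1) (k + 4) with hm | hm
      · rw [countingMachine_next_lt hm, RatDist.dirac_inSupp] at hsupp
        subst hsupp
        rw [countingMachine_update_s₁ hm]
        change c + 1 + 1 = 2 * (m + 1)
        omega
      · rw [countingMachine_next_last (by omega), RatDist.dirac_inSupp] at hsupp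
        subst hsupp
        change c + μ / 2 < μ
        omega
    · dsimp only at hc
      have := m.2
      rcases hedge with rfl | rfl
      · exact hc
      · change c + 1 < μ
        omega
    · exact absurd rfl hs

theorem costFrom_countingMachine (h : μ = 13 + 4 * k) (i : ℕ) (m : Fin (k + 4))
    (hi : (m : ℕ) + i = k + 3) :
    costFrom {.s₃} (countingMachine k μ hμ) (familyModel μ hμ) .s₁ m () =
      ENNReal.ofReal (loopValue k i : ℝ) := by
  induction i generalizing m with
  | zero =>
    rw [costFrom_familyGame_s₁, countingMachine_next_last (by omega), RatDist.mean_dirac,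
      costFrom_of_mem (Set.mem_singleton _), add_zero, ofReal_loopValue_zero h]
    rfl
  | succ i ih =>
    have hm : (m : ℕ) + 1 < k + 4 := by omega
    rw [costFrom_familyGame_s₁, countingMachine_next_lt hm, RatDist.mean_dirac,
      countingMachine_update_s₁ hm, ← ofReal_loopValue_succ,
      ← ih ⟨m + 1, hm⟩ (show (m : ℕ) + 1 + i = k + 3 by omega)]
    change ((1 : ℕ) : ℝ≥0∞) + _ = _
    rw [Nat.cast_one, costFrom_familyGame_s₂]
    rfl

theorem satisfies_countingMachine (h : μ = 13 + 4 * k) :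
    Satisfies .s₁ {.s₃} (familyModel μ hμ) μ (loopValue k (k + 2)) (countingMachine k μ hμ) := by
  refine satisfies_iff.2 ⟨safeFrom_countingMachine h, ?_⟩
  change costFrom _ _ _ _ (0 : Fin (k + 4)) () < _
  rw [costFrom_countingMachine h (k + 3) 0 (by simp)]
  have hlt : (loopValue k (k + 3) : ℝ) < loopValue k (k + 2) := by
    exact_mod_cast loopValue_succ_lt (k + 2)
  have hpos : (0 : ℚ) < loopValue k (k + 2) := by
    unfold loopValue
    positivity
  exact (ENNReal.ofReal_lt_ofReal_iff (by exact_mod_cast hpos)).2 hlt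

/-! ### Every machine has to loop that often, and has to count its loops -/

/-- The memory of `M₁` after `j` loops from `s₁` via `s₂` to `s₁`. -/
def loopMem (M₁ : MooreMachine (familyGame μ hμ) .one Mem₁) (j : ℕ) : Mem₁ :=
  (fun m => M₁.update (M₁.update m .s₁) .s₂)^[j] M₁.init

/-- The machine `M₁` may move from `s₁` to `s₂` after `j` loops. -/
def Loops (M₁ : MooreMachine (familyGame μ hμ) .one Mem₁) (j : ℕ) : Prop :=
  (M₁.next (loopMem M₁ j) .s₁).InSupp .s₂

variable {M₁ : MooreMachine (familyGame μ hμ) .one Mem₁}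

theorem loopMem_succ (j : ℕ) :
    loopMem M₁ (j + 1) = M₁.update (M₁.update (loopMem M₁ j) .s₁) .s₂ :=
  Function.iterate_succ_apply' _ _ _

theorem SafeFrom.loop {m : Mem₁} {c : ℕ} (h : SafeFrom {.s₃} μ M₁ .s₁ m c)
    (hm : (M₁.next m .s₁).InSupp .s₂) :
    SafeFrom {.s₃} μ M₁ .s₁ (M₁.update (M₁.update m .s₁) .s₂) (c + 2) := by
  have h₁₂ : Allowed M₁ m .s₁ .s₂ := ⟨Or.inl rfl, fun _ => hm⟩
  have h₂₁ : Allowed M₁ (M₁.update m .s₁) .s₂ .s₁ := ⟨Or.inl rfl, fun ho => by cases ho⟩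
  exact (h.step (by simp) h₁₂).step (by simp) h₂₁

/-- The adversary can always force another loop, so that safety in `s₁` needs a reserve for the
direct move to `s₃`. -/
theorem SafeFrom.add_half_lt {m : Mem₁} {c : ℕ} (h : SafeFrom {.s₃} μ M₁ .s₁ m c) :
    c + μ / 2 < μ := by
  induction hd : μ - c using Nat.strong_induction_on generalizing m c with
  | _ d ih =>
    have hc := h.lt
    obtain ⟨t, ht⟩ := exists_allowed M₁ m .s₁
    rcases ht.1 with rfl | rfl
    · have := ih (μ - (c + 2)) (by omega) (h.loop (ht.2 rfl)) rfl
      omega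
    · exact (h.step (by simp) ht).lt

theorem safeFrom_loopMem (h : SafeFrom {.s₃} μ M₁ .s₁ M₁.init 0) {j : ℕ}
    (hj : ∀ i < j, Loops M₁ i) : SafeFrom {.s₃} μ M₁ .s₁ (loopMem M₁ j) (2 * j) := by
  induction j with
  | zero => exact h
  | succ j ih =>
    rw [loopMem_succ]
    exact (ih fun i hi => hj i (by omega)).loop (hj j (by omega))

/-- A machine that stops looping after `j` loops at the latest has the expected cost of `j` loops
at least. -/
theorem loopValue_le_costFrom [Fintype Mem₁] (h : μ = 13 + 4 * k) {j : ℕ} (hj : ¬ Loops M₁ j)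
    (i : ℕ) (hi : i ≤ j) : ENNReal.ofReal (loopValue k i : ℝ) ≤
      costFrom {.s₃} M₁ (familyModel μ hμ) .s₁ (loopMem M₁ (j - i)) () := by
  have hexit : ∀ i, ENNReal.ofReal (loopValue k i : ℝ) ≤ ((μ / 2 : ℕ) : ℝ≥0∞) := by
    intro i
    rw [← ofReal_loopValue_zero h]
    exact ENNReal.ofReal_le_ofReal (by exact_mod_cast loopValue_anti (Nat.zero_le i))
  induction i with
  | zero =>
    rw [costFrom_familyGame_s₁]
    refine RatDist.le_mean _ fun t ht => ?_
    rcases M₁.supp _ _ rfl t ht with rfl | rfl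
    · exact absurd ht hj
    · exact (hexit 0).trans le_self_add
  | succ i ih =>
    rw [costFrom_familyGame_s₁]
    refine RatDist.le_mean _ fun t ht => ?_
    rcases M₁.supp _ _ rfl t ht with rfl | rfl
    · change _ ≤ ((1 : ℕ) : ℝ≥0∞) + _
      rw [Nat.cast_one, costFrom_familyGame_s₂, ← loopMem_succ,
        show j - (i + 1) + 1 = j - i by omega, ← ofReal_loopValue_succ]
      gcongr
      exact ih (by omega)
    · exact (hexit _).trans le_self_add

theorem Satisfies.le_card [Fintype Mem₁] (h : μ = 13 + 4 * k)
    (hsat : Satisfies .s₁ {.s₃} (familyModel μ hμ) μ (loopValue k (k + 2)) M₁) :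
    k + 4 ≤ Fintype.card Mem₁ := by
  obtain ⟨hsafe, hcost⟩ := satisfies_iff.1 hsat
  -- The expectation forces `k + 3` loops.
  have hloops : ∀ j < k + 3, Loops M₁ j := by
    intro j hj
    by_contra hn
    have hle := loopValue_le_costFrom h hn j le_rfl
    rw [Nat.sub_self] at hle
    refine absurd hcost (not_lt.2 (le_trans ?_ hle))
    exact ENNReal.ofReal_le_ofReal (by exact_mod_cast loopValue_anti (by omega))
  -- The worst case forbids one more.
  have hlast : ¬ Loops M₁ (k + 3) := by
    intro hl
    have := ((safeFrom_loopMem hsafe hloops).loop hl).add_half_lt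
    omega
  -- If the memory repeated, the machine would not notice the last loop.
  have hinj : Function.Injective fun j : Fin (k + 4) => loopMem M₁ j := by
    have hne : ∀ i j : Fin (k + 4), i < j → loopMem M₁ i ≠ loopMem M₁ j := by
      intro i j hij heq
      have hshift : ∀ d, loopMem M₁ (i + d) = loopMem M₁ (j + d) := by
        intro d
        induction d with
        | zero => exact heq
        | succ d ih => rw [← add_assoc, ← add_assoc, loopMem_succ, loopMem_succ, ih]
      have hj := j.2
      have hij' : (i : ℕ) < j := hij
      have hmem := hshift (k + 3 - j)
      rw [show (j : ℕ) + (k + 3 - j) = k + 3 by omega] at hmem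
      refine hlast ?_
      rw [Loops, ← hmem]
      exact hloops _ (by omega)
    intro i j hij
    rcases lt_trichotomy i j with hlt | heq | hgt
    · exact absurd hij (hne i j hlt)
    · exact heq
    · exact absurd hij.symm (hne j i hgt)
  simpa using Fintype.card_le_of_injective _ hinj

theorem loopValue_lt : loopValue k (k + 2) < ((13 + 4 * k : ℕ) : ℚ) := by
  refine (loopValue_anti (Nat.zero_le _)).trans_lt ?_
  rw [loopValue_zero]
  push_cast
  have : (0 : ℚ) ≤ k := Nat.cast_nonneg k
  linarith

end Family
end BWC

theorem mainTheorem7 :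
    (∀ (S : Type*) [Fintype S] (G : BWC.Game S) (s₀ : S) (T : Set S)
      (Mem₂ : Type*) [Fintype Mem₂] (M₂ : BWC.MooreMachine G .two Mem₂) (μ : ℕ) (ν : ℚ),
      (∃ (Mem₁ : Type) (_ : Fintype Mem₁) (M₁ : BWC.MooreMachine G .one Mem₁),
        BWC.Satisfies s₀ T M₂ μ ν M₁) →
      ∃ σ : BWC.MooreMachine (BWC.unfoldedProduct M₂ μ) .one Unit,
        BWC.StaysInWinningRegion T M₂ μ σ ∧
        BWC.Satisfies s₀ T M₂ μ ν (BWC.translateBack M₂ μ σ) ∧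
        Fintype.card (BWC.UnfoldedMemory S μ Mem₂) ≤
          (Fintype.card S + 1) * (μ + 1) * Fintype.card Mem₂) ∧
    (∀ (k μ : ℕ) (hμ : μ = 13 + 4 * k), ∃ ν : ℚ, ν < μ ∧
      (∃ (Mem₁ : Type) (_ : Fintype Mem₁)
        (M₁ : BWC.MooreMachine (BWC.familyGame μ (by omega)) .one Mem₁),
        BWC.Satisfies .s₁ {.s₃} (BWC.familyModel μ (by omega)) μ ν M₁) ∧
      (∀ (Mem₁ : Type*) [Fintype Mem₁]
        (M₁ : BWC.MooreMachine (BWC.familyGame μ (by omega)) .one Mem₁),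
        BWC.Satisfies .s₁ {.s₃} (BWC.familyModel μ (by omega)) μ ν M₁ →
          (μ : ℝ) / 4 < Fintype.card Mem₁)) := by
  refine ⟨?_, ?_⟩
  · rintro S _ G s₀ T Mem₂ _ M₂ μ ν ⟨Mem₁, _, M₁, h⟩
    exact ⟨BWC.optimalStrategy T M₂ μ, BWC.optimalStrategy_stays, h.translateBack,
      (BWC.card_unfoldedMemory S μ Mem₂).le⟩
  · intro k μ hμ
    refine ⟨BWC.loopValue k (k + 2), hμ ▸ BWC.loopValue_lt,
      ⟨Fin (k + 4), inferInstance, BWC.countingMachine k μ _, BWC.satisfies_countingMachine hμ⟩, ?_⟩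
    intro Mem₁ _ M₁ h
    have hcard : ((k + 4 : ℕ) : ℝ) ≤ Fintype.card Mem₁ := by exact_mod_cast h.le_card hμ
    rw [hμ]
    push_cast at hcard ⊢
    linarith
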